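/- Let $\mathcal V$ be a countably infinite set of variables and let $\mathcal F$ be a signature, i.e. a (possibly infinite) set of function symbols, each with a fixed arity. A term rewrite system (TRS) $\mathcal R$ over $\mathcal F$ is a (possibly infinite) set of rewrite rules $\ell \to r$ between terms $\ell, r \in \mathcal T(\mathcal F,\mathcal V)$ such that $\ell$ is not a variable and every variable of $r$ occurs in $\ell$. Its rewrite relation $\to_{\mathcal R}$ is the closure of the rules under substitutions and contexts, and $\mathcal R$ is confluent if any two terms reachable by $\to_{\mathcal R}^*$ from a common term can be rewritten by $\to_{\mathcal R}^*$ to a common term. The curried signature consists of a fresh binary symbol $\mathsf{Ap}$ and a constant $f_0$ for each $f \in \mathcal F$. For terms over $\mathcal F$ put $\mathsf{Cu}(x) = x$ for variables $x$ and $$\mathsf{Cu}(f(t_1,\dots,t_n)) = \mathsf{Ap}(\cdots\mathsf{Ap}(\mathsf{Ap}(f_0,\mathsf{Cu}(t_1)),\mathsf{Cu}(t_2))\cdots,\mathsf{Cu}(t_n))$$ (with $n$ occurrences of $\mathsf{Ap}$ displayed; in particular $\mathsf{Cu}(f) = f_0$ if $f$ is a constant). The curried version of $\mathcal R$ is the TRS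 $\mathsf{Cu}(\mathcal R) = \{\mathsf{Cu}(\ell) \to \mathsf{Cu}(r) \mid \ell \to r \in \mathcal R\}$ over the curried signature and the variables $\mathcal V$. Theorem. If $\mathcal R$ is confluent, then $\mathsf{Cu}(\mathcal R)$ is confluent. -/

import Mathlib

universe u v w

namespace Rewriting

/-- A rewrite rule `lhs → rhs` over the signature given by the function symbols of `L`
(relation symbols of `L` play no role): `lhs` is not a variable, and every variable of `rhs`
occurs in `lhs`. -/
@[ext]
structure Rule (L : FirstOrder.Language.{u, v}) (V : Type w) where
  lhs : L.Term V
  rhs : L.Term V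
  lhs_ne_var : ∀ x : V, lhs ≠ FirstOrder.Language.Term.var x
  vars_subset : open Classical in (rhs.varFinset : Finset V) ⊆ lhs.varFinset

/-- A term rewrite system over the signature `L` and the variables `V`: an arbitrary
(possibly infinite) set of rewrite rules. -/
abbrev TRS (L : FirstOrder.Language.{u, v}) (V : Type w) := Set (Rule L V)

/-- The rewrite relation of a TRS: an instance of a rule is applied at the root, or a rewrite
step is performed inside one argument. -/
inductive TRS.Step {L : FirstOrder.Language.{u, v}} {V : Type w} (R : TRS L V) :
    L.Term V → L.Term V → Prop
  | root (ρ : Rule L V) (hρ : ρ ∈ R) (σ : V → L.Term V) :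
      TRS.Step R (ρ.lhs.subst σ) (ρ.rhs.subst σ)
  | arg {n : ℕ} (f : L.Functions n) (ts : Fin n → L.Term V) (i : Fin n) (t : L.Term V) :
      TRS.Step R (ts i) t →
      TRS.Step R (FirstOrder.Language.Term.func f ts)
        (FirstOrder.Language.Term.func f (Function.update ts i t))

/-- A relation is confluent if any two elements reachable from a common element
have a common reduct. -/
def Confluent {α : Type*} (r : α → α → Prop) : Prop :=
  ∀ a b c, Relation.ReflTransGen r a b → Relation.ReflTransGen r a c →
    Relation.Join (Relation.ReflTransGen r) b c

/-- A TRS is confluent if its rewrite relation on all terms is. -/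
def TRS.IsConfluent {L : FirstOrder.Language.{u, v}} {V : Type w} (R : TRS L V) : Prop :=
  Confluent R.Step

/-- The symbols of the curried signature, indexed by their arity: a constant `f₀` for every
function symbol `f` (of any arity), and a fresh binary symbol `Ap`. -/
inductive CurriedFunctions (L : FirstOrder.Language.{u, v}) : ℕ → Type u
  | const {n : ℕ} (f : L.Functions n) : CurriedFunctions L 0
  | ap : CurriedFunctions L 2

/-- The curried signature. -/
def curriedLanguage (L : FirstOrder.Language.{u, v}) : FirstOrder.Language.{u, 0} where
  Functions := CurriedFunctions L
  Relations := fun _ => Empty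

section
variable {L : FirstOrder.Language.{u, v}} {V : Type w}

/-- The term `f₀`. -/
def constTerm {n : ℕ} (f : L.Functions n) : (curriedLanguage L).Term V :=
  FirstOrder.Language.Term.func (L := curriedLanguage L) (CurriedFunctions.const f) Fin.elim0

/-- The term `Ap(s, t)`. -/
def apTerm (s t : (curriedLanguage L).Term V) : (curriedLanguage L).Term V :=
  FirstOrder.Language.Term.func (L := curriedLanguage L) CurriedFunctions.ap ![s, t]

/-- Currying of terms: `Cu(x) = x` and
`Cu(f(t₁, …, tₙ)) = Ap(⋯ Ap(Ap(f₀, Cu(t₁)), Cu(t₂)) ⋯, Cu(tₙ))`. -/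
def curryTerm : L.Term V → (curriedLanguage L).Term V
  | .var x => .var x
  | .func (l := n) f ts =>
      Fin.foldl n (fun s i => apTerm s (curryTerm (ts i))) (constTerm f)

theorem curryTerm_ne_var {t : L.Term V} (ht : ∀ x : V, t ≠ FirstOrder.Language.Term.var x)
    (x : V) :
    curryTerm t ≠ FirstOrder.Language.Term.var x := by
  cases t with
  | var y => exact absurd rfl (ht y)
  | @func n f ts =>
    cases n with
    | zero => simp [curryTerm, constTerm]
    | succ n => simp [curryTerm, Fin.foldl_succ_last, apTerm]

open Classical in
theorem varFinset_apTerm (s t : (curriedLanguage L).Term V) :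
    (apTerm s t).varFinset = s.varFinset ∪ t.varFinset := by
  ext x
  simp [apTerm, FirstOrder.Language.Term.varFinset, Fin.exists_fin_two]

open Classical in
theorem varFinset_foldl_apTerm (n : ℕ) (ts : Fin n → (curriedLanguage L).Term V)
    (s : (curriedLanguage L).Term V) :
    (Fin.foldl n (fun s i => apTerm s (ts i)) s).varFinset =
      s.varFinset ∪ Finset.univ.biUnion fun i => (ts i).varFinset := by
  induction n with
  | zero => simp
  | succ n ih =>
    ext x
    simp [Fin.foldl_succ_last, varFinset_apTerm, ih, Fin.exists_fin_succ']

open Classical in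
theorem varFinset_curryTerm (t : L.Term V) : (curryTerm t).varFinset = t.varFinset := by
  induction t with
  | var x => rfl
  | func f ts ih =>
    simp only [curryTerm]
    rw [varFinset_foldl_apTerm]
    ext x
    simp [constTerm, FirstOrder.Language.Term.varFinset, ih]

/-- The curried rule `Cu(ℓ) → Cu(r)`. -/
def Rule.curry (ρ : Rule L V) : Rule (curriedLanguage L) V where
  lhs := curryTerm ρ.lhs
  rhs := curryTerm ρ.rhs
  lhs_ne_var := curryTerm_ne_var ρ.lhs_ne_var
  vars_subset := by
    rw [varFinset_curryTerm, varFinset_curryTerm]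
    exact ρ.vars_subset

/-- The curried version `Cu(R)` of a TRS `R`. -/
def TRS.curry (R : TRS L V) : TRS (curriedLanguage L) V :=
  Rule.curry '' R

end

end Rewriting

/-! A curried term has a saturated top layer, which is an ordinary term over the original signature,
with the maximal unsaturated subterms (aliens) hanging below it. Every left-hand side instance is
saturated, so a step takes place either in the top layer, where it is a step of `R`, or inside an
alien. The difficulty is that an alien may become saturated and merge with the layer above it.

If no alien can do so and rewriting is confluent at every alien, the aliens can be replaced by
variables, one for each joinability class. Rewriting then projects to `R`, and a common reduct found
there is lifted back by putting a common reduct of the class for each variable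
(`StableAliens.confluentAt`).

The general case is an induction on the nesting depth of aliens, the rank. Steps do not increase it,
and an alien that becomes saturated loses at least one level (`RankLE.of_reduces_isSaturated`).
Hence each term reduces to one whose aliens never become saturated
(`exists_reduct_preserved_aliens`), and aliens of the current rank inherit confluence from their two
immediate subterms and from saturated terms of smaller rank (`confluentAt_apTerm`). Normalizing the
aliens of all terms in a peak in the same way turns the peak into a chain of joinable terms at which
rewriting is confluent (`confluentAt_of_rankLE`). -/

namespace Rewriting

open FirstOrder.Language Relation

/-! ### Pointwise confluence and joinability classes -/

section Abstract
variable {α : Type*} {r : α → α → Prop}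

/-- Every peak starting at `a` can be joined. -/
def ConfluentAt (r : α → α → Prop) (a : α) : Prop :=
  ∀ b c, ReflTransGen r a b → ReflTransGen r a c → Join (ReflTransGen r) b c

theorem ConfluentAt.reduct {a b : α} (ha : ConfluentAt r a) (h : ReflTransGen r a b) :
    ConfluentAt r b :=
  fun _ _ hc hd => ha _ _ (h.trans hc) (h.trans hd)

theorem ConfluentAt.join_trans {a b c : α} (hb : ConfluentAt r b)
    (h₁ : Join (ReflTransGen r) a b) (h₂ : Join (ReflTransGen r) b c) :
    Join (ReflTransGen r) a c := by
  obtain ⟨d, had, hbd⟩ := h₁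
  obtain ⟨e, hbe, hce⟩ := h₂
  obtain ⟨z, hdz, hez⟩ := hb _ _ hbd hbe
  exact ⟨z, had.trans hdz, hce.trans hez⟩

theorem join_symm {a b : α} (h : Join (ReflTransGen r) a b) : Join (ReflTransGen r) b a := by
  obtain ⟨c, h₁, h₂⟩ := h
  exact ⟨c, h₂, h₁⟩

/-- Finitely many pairwise joinable elements at which the relation is confluent have a common
reduct. -/
theorem exists_common_reduct [Nonempty α] (A : Finset α) (hc : ∀ a ∈ A, ConfluentAt r a)
    (hj : ∀ a ∈ A, ∀ b ∈ A, Join (ReflTransGen r) a b) : ∃ z, ∀ a ∈ A, ReflTransGen r a z := by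
  classical
  induction A using Finset.induction_on with
  | empty => exact ⟨Classical.arbitrary α, by simp⟩
  | insert a A _ ih =>
    obtain ⟨z, hz⟩ := ih (fun b hb => hc b (Finset.mem_insert_of_mem hb)) fun b hb c hc =>
      hj b (Finset.mem_insert_of_mem hb) c (Finset.mem_insert_of_mem hc)
    obtain rfl | ⟨b, hb⟩ := A.eq_empty_or_nonempty
    · exact ⟨a, by simp [ReflTransGen.refl]⟩
    · obtain ⟨y, hay, hzy⟩ := (hc b (Finset.mem_insert_of_mem hb)).join_trans
        (hj a (Finset.mem_insert_self _ _) b (Finset.mem_insert_of_mem hb))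
        ⟨z, hz b hb, .refl⟩
      refine ⟨y, fun c hc => ?_⟩
      obtain rfl | hc := Finset.mem_insert.1 hc
      · exact hay
      · exact (hz c hc).trans hzy

/-- The elements that are joinable with `a` and at which the relation is confluent. On the elements
at which the relation is confluent, this is a complete invariant of joinability. -/
def joinClass (r : α → α → Prop) (a : α) : Set α :=
  {b | ConfluentAt r b ∧ Join (ReflTransGen r) a b}

theorem joinClass_eq_of_reduces {a b : α} (ha : ConfluentAt r a) (h : ReflTransGen r a b) :
    joinClass r b = joinClass r a := by
  ext c
  refine and_congr_right fun _ => ⟨fun hj => ?_, fun hj => ?_⟩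
  · exact (ha.reduct h).join_trans ⟨b, h, .refl⟩ hj
  · exact ha.join_trans ⟨b, .refl, h⟩ hj

theorem join_of_joinClass_eq {a b : α} (hb : ConfluentAt r b) (h : joinClass r a = joinClass r b) :
    Join (ReflTransGen r) a b := by
  have : b ∈ joinClass r b := ⟨hb, b, .refl, .refl⟩
  rw [← h] at this
  exact this.2

end Abstract

/-- Terms over the curried signature. -/
abbrev CurriedTerm (L : FirstOrder.Language.{u, v}) (V : Type w) := (curriedLanguage L).Term V

/-! ### Curried terms, saturation and top layers -/

section Curried
variable {L : FirstOrder.Language.{u, v}} {V : Type w}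

/-- `apps f ts` is the constant `f₀` applied to the arguments `ts`, whose number may differ from
the arity of `f`. -/
def apps {n : ℕ} (f : L.Functions n) {k : ℕ} (ts : Fin k → CurriedTerm L V) : CurriedTerm L V :=
  Fin.foldl k (fun s i => apTerm s (ts i)) (constTerm f)

theorem apps_zero {n : ℕ} (f : L.Functions n) (ts : Fin 0 → CurriedTerm L V) :
    apps f ts = constTerm f := by
  simp [apps]

theorem apps_succ {n : ℕ} (f : L.Functions n) {k : ℕ} (ts : Fin (k + 1) → CurriedTerm L V) :
    apps f ts = apTerm (apps f fun i => ts i.castSucc) (ts (Fin.last k)) := by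
  simp [apps, Fin.foldl_succ_last]

theorem apTerm_inj {s t s' t' : CurriedTerm L V} :
    apTerm s t = apTerm s' t' ↔ s = s' ∧ t = t' := by
  refine ⟨fun h => ?_, fun ⟨h, h'⟩ => h ▸ h' ▸ rfl⟩
  have h' : (![s, t] : Fin 2 → CurriedTerm L V) = ![s', t'] := eq_of_heq (Term.func.inj h).2.2
  exact ⟨congrFun h' 0, congrFun h' 1⟩

theorem constTerm_ne_apTerm {n : ℕ} (f : L.Functions n) (s t : CurriedTerm L V) :
    constTerm f ≠ apTerm s t := by
  intro h
  exact absurd (Term.func.inj h).1 (by decide)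

/-- The equation lives in sigma types because neither the arities nor the numbers of arguments are
known to agree beforehand. -/
theorem apps_unique {n m : ℕ} {f : L.Functions n} {g : L.Functions m} {k j : ℕ}
    {ts : Fin k → CurriedTerm L V} {us : Fin j → CurriedTerm L V} (h : apps f ts = apps g us) :
    (⟨⟨n, f⟩, ⟨k, ts⟩⟩ : (Σ n, L.Functions n) × (Σ k, Fin k → CurriedTerm L V)) =
      ⟨⟨m, g⟩, ⟨j, us⟩⟩ := by
  induction k generalizing j with
  | zero =>
    cases j with
    | zero =>
      rw [apps_zero, apps_zero] at h
      obtain rfl : ts = us := Subsingleton.elim _ _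
      have h' : (CurriedFunctions.const f : CurriedFunctions L 0) = .const g :=
        eq_of_heq (Term.func.inj h).2.1
      cases h'
      rfl
    | succ j => rw [apps_zero, apps_succ] at h; exact absurd h (constTerm_ne_apTerm _ _ _)
  | succ k ih =>
    cases j with
    | zero => rw [apps_zero, apps_succ] at h; exact absurd h.symm (constTerm_ne_apTerm _ _ _)
    | succ j =>
      rw [apps_succ, apps_succ, apTerm_inj] at h
      have h' := ih h.1
      simp only [Prod.mk.injEq, Sigma.mk.injEq] at h'
      obtain ⟨⟨rfl, hf⟩, rfl, hi⟩ := h'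
      cases hf
      have hts : ts = us := by
        funext i
        refine Fin.lastCases h.2 (fun i => congrFun (eq_of_heq hi) i) i
      rw [hts]

/-- The number of symbols of a curried term. -/
def size : CurriedTerm L V → ℕ
  | .var _ => 1
  | .func _ ts => 1 + ∑ i, size (ts i)

theorem size_apTerm (s t : CurriedTerm L V) : size (apTerm s t) = 1 + (size s + size t) := by
  change 1 + ∑ i : Fin 2, size (![s, t] i) = _
  exact congrArg _ (Fin.sum_univ_two _)

theorem size_lt_size_apps {n : ℕ} (f : L.Functions n) {k : ℕ} (ts : Fin k → CurriedTerm L V)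
    (i : Fin k) : size (ts i) < size (apps f ts) := by
  induction k with
  | zero => exact i.elim0
  | succ k ih =>
    rw [apps_succ, size_apTerm]
    refine Fin.lastCases ?_ (fun i => ?_) i
    · omega
    · have := ih (fun i => ts i.castSucc) i
      omega

/-- A curried term is saturated if it is a function symbol applied to exactly as many arguments
as its arity prescribes. -/
def IsSaturated (t : CurriedTerm L V) : Prop :=
  ∃ p : Σ n, L.Functions n × (Fin n → CurriedTerm L V), t = apps p.2.1 p.2.2

theorem isSaturated_apps {n : ℕ} (f : L.Functions n) (ts : Fin n → CurriedTerm L V) :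
    IsSaturated (apps f ts) :=
  ⟨⟨n, f, ts⟩, rfl⟩

theorem not_isSaturated_apps {n : ℕ} (f : L.Functions n) {k : ℕ} (ts : Fin k → CurriedTerm L V)
    (h : k < n) : ¬ IsSaturated (apps f ts) := by
  rintro ⟨⟨m, g, us⟩, e⟩
  have := apps_unique e
  simp only [Prod.mk.injEq, Sigma.mk.injEq] at this
  omega

/-- Induction along the decomposition of curried terms into saturated applications and the
remaining terms. -/
theorem layer_induction {P : CurriedTerm L V → Prop}
    (alien : ∀ a, ¬ IsSaturated a → (∀ s t, a = apTerm s t → P s ∧ P t) → P a)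
    (saturated : ∀ {n : ℕ} (f : L.Functions n) (ts : Fin n → CurriedTerm L V),
      (∀ i, P (ts i)) → P (apps f ts)) (t : CurriedTerm L V) : P t := by
  induction h : size t using Nat.strong_induction_on generalizing t with
  | _ n ih =>
    subst h
    by_cases ht : IsSaturated t
    · obtain ⟨⟨n, f, ts⟩, rfl⟩ := ht
      exact saturated f ts fun i => ih _ (size_lt_size_apps f ts i) _ rfl
    · refine alien t ht ?_
      rintro s u rfl
      rw [size_apTerm] at ih
      exact ⟨ih _ (by omega) s rfl, ih _ (by omega) u rfl⟩

open Classical in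
/-- The maximal saturated top layer of a curried term, as an uncurried term whose variables are
the maximal unsaturated subterms, called aliens. -/
noncomputable def top (t : CurriedTerm L V) : L.Term (CurriedTerm L V) :=
  if h : IsSaturated t then
    .func h.choose.2.1 fun i => top (h.choose.2.2 i)
  else .var t
termination_by size t
decreasing_by
  exact (size_lt_size_apps _ _ i).trans_eq (congrArg size h.choose_spec).symm

theorem top_apps {n : ℕ} (f : L.Functions n) (ts : Fin n → CurriedTerm L V) :
    top (apps f ts) = .func f fun i => top (ts i) := by
  have h := isSaturated_apps f ts
  rw [top, dif_pos h]
  have e : h.choose = ⟨n, f, ts⟩ := by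
    have hs := apps_unique h.choose_spec
    generalize h.choose = p at hs
    obtain ⟨m, g, us⟩ := p
    simp only [Prod.mk.injEq, Sigma.mk.injEq] at hs
    obtain ⟨⟨rfl, hf⟩, -, hu⟩ := hs
    cases hf; cases hu; rfl
  rw [e]

theorem top_of_not_isSaturated {t : CurriedTerm L V} (h : ¬ IsSaturated t) : top t = .var t := by
  rw [top, dif_neg h]

/-- Instances of curried terms. -/
def fill {W : Type*} (σ : W → CurriedTerm L V) (l : L.Term W) : CurriedTerm L V :=
  (curryTerm l).subst σ

@[simp] theorem fill_var {W : Type*} (σ : W → CurriedTerm L V) (x : W) : fill σ (.var x) = σ x := by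
  simp [fill, curryTerm, Term.subst]

theorem subst_apTerm {W : Type*} (σ : W → CurriedTerm L V) (s t : CurriedTerm L W) :
    (apTerm s t).subst σ = apTerm (s.subst σ) (t.subst σ) := by
  refine congrArg (Term.func (L := curriedLanguage L) CurriedFunctions.ap) (funext fun i => ?_)
  fin_cases i <;> rfl

theorem subst_apps {W : Type*} (σ : W → CurriedTerm L V) {n : ℕ} (f : L.Functions n) {k : ℕ}
    (ts : Fin k → CurriedTerm L W) : (apps f ts).subst σ = apps f fun i => (ts i).subst σ := by
  induction k with
  | zero =>
    rw [apps_zero, apps_zero]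
    exact congrArg (Term.func (L := curriedLanguage L) (CurriedFunctions.const f))
      (Subsingleton.elim _ _)
  | succ k ih => rw [apps_succ, apps_succ, subst_apTerm, ih]

@[simp] theorem fill_func {W : Type*} (σ : W → CurriedTerm L V) {n : ℕ} (f : L.Functions n)
    (ts : Fin n → L.Term W) : fill σ (.func f ts) = apps f fun i => fill σ (ts i) := by
  rw [fill, curryTerm]
  exact subst_apps σ f fun i => curryTerm (ts i)

theorem fill_subst {W W' : Type*} (σ : W' → CurriedTerm L V) (τ : W → L.Term W') (l : L.Term W) :
    fill σ (l.subst τ) = fill (fun x => fill σ (τ x)) l := by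
  induction l with
  | var x => simp [Term.subst]
  | func f ts ih => simp [Term.subst, ih]

theorem top_fill {W : Type*} (σ : W → CurriedTerm L V) (l : L.Term W) :
    top (fill σ l) = l.subst fun x => top (σ x) := by
  induction l with
  | var x => simp [Term.subst]
  | func f ts ih => simp [Term.subst, ih, top_apps]

theorem fill_top (t : CurriedTerm L V) : fill id (top t) = t := by
  induction t using layer_induction with
  | alien a ha _ => rw [top_of_not_isSaturated ha, fill_var, id]
  | saturated f ts ih => simp [top_apps, ih]

/-! ### Variables and aliens -/

open Classical in
/-- `x` is a variable of `t`. -/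
def OccursIn {W : Type*} (x : W) (t : L.Term W) : Prop := x ∈ t.varFinset

@[simp] theorem occursIn_var {W : Type*} (x y : W) : OccursIn x (.var y : L.Term W) ↔ x = y := by
  simp [OccursIn, Term.varFinset]

@[simp] theorem occursIn_func {W : Type*} (x : W) {n : ℕ} (f : L.Functions n)
    (ts : Fin n → L.Term W) : OccursIn x (.func f ts) ↔ ∃ i, OccursIn x (ts i) := by
  simp [OccursIn, Term.varFinset]

theorem finite_occursIn {W : Type*} (t : L.Term W) : {x | OccursIn x t}.Finite := by
  classical exact t.varFinset.finite_toSet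

theorem occursIn_subst {W W' : Type*} (τ : W → L.Term W') (l : L.Term W) (x : W') :
    OccursIn x (l.subst τ) ↔ ∃ y, OccursIn y l ∧ OccursIn x (τ y) := by
  induction l with
  | var y => simp [Term.subst]
  | func f ts ih =>
    simp only [Term.subst, occursIn_func, ih]
    exact ⟨fun ⟨i, y, h, h'⟩ => ⟨y, ⟨i, h⟩, h'⟩, fun ⟨y, ⟨i, h⟩, h'⟩ => ⟨i, y, h, h'⟩⟩

/-- The aliens of a curried term are its maximal unsaturated subterms. -/
def aliens (t : CurriedTerm L V) : Set (CurriedTerm L V) := {a | OccursIn a (top t)}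

theorem mem_aliens_fill {W : Type*} {σ : W → CurriedTerm L V} {l : L.Term W}
    {a : CurriedTerm L V} : a ∈ aliens (fill σ l) ↔ ∃ x, OccursIn x l ∧ a ∈ aliens (σ x) := by
  simp only [aliens, Set.mem_ofPred_eq, top_fill, occursIn_subst]

theorem mem_aliens_apps {n : ℕ} {f : L.Functions n} {ts : Fin n → CurriedTerm L V}
    {a : CurriedTerm L V} : a ∈ aliens (apps f ts) ↔ ∃ i, a ∈ aliens (ts i) := by
  simp [aliens, top_apps]

theorem mem_aliens_of_not_isSaturated {t a : CurriedTerm L V} (h : ¬ IsSaturated t) :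
    a ∈ aliens t ↔ a = t := by
  simp [aliens, top_of_not_isSaturated h]

theorem not_isSaturated_of_mem_aliens {t a : CurriedTerm L V} (h : a ∈ aliens t) :
    ¬ IsSaturated a := by
  induction t using layer_induction with
  | alien b hb _ => rw [mem_aliens_of_not_isSaturated hb] at h; rwa [h]
  | saturated f ts ih => obtain ⟨i, hi⟩ := mem_aliens_apps.1 h; exact ih i hi

/-- Aliens of an instance come only from the substituted terms, so the variable condition on rules
prevents a root step from creating new ones. -/
theorem aliens_fill_rhs_subset (ρ : Rule L V) (σ : V → CurriedTerm L V) :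
    aliens (fill σ ρ.rhs) ⊆ aliens (fill σ ρ.lhs) := by
  intro a ha
  obtain ⟨x, hx, hxa⟩ := mem_aliens_fill.1 ha
  exact mem_aliens_fill.2 ⟨x, ρ.vars_subset hx, hxa⟩

theorem isSaturated_fill_lhs (ρ : Rule L V) (σ : V → CurriedTerm L V) :
    IsSaturated (fill σ ρ.lhs) := by
  have h := ρ.lhs_ne_var
  generalize ρ.lhs = l at h
  cases l with
  | var x => exact absurd rfl (h x)
  | func f ts => rw [fill_func]; exact isSaturated_apps _ _

/-! ### Rewriting curried terms -/

/-- The rewrite relation of the curried system, with its steps below the root spelled out. -/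
inductive CurriedStep (R : TRS L V) : CurriedTerm L V → CurriedTerm L V → Prop
  | root (ρ : Rule L V) (hρ : ρ ∈ R) (σ : V → CurriedTerm L V) :
      CurriedStep R (fill σ ρ.lhs) (fill σ ρ.rhs)
  | left {s s' : CurriedTerm L V} (t : CurriedTerm L V) :
      CurriedStep R s s' → CurriedStep R (apTerm s t) (apTerm s' t)
  | right (s : CurriedTerm L V) {t t' : CurriedTerm L V} :
      CurriedStep R t t' → CurriedStep R (apTerm s t) (apTerm s t')

theorem step_curry_iff {R : TRS L V} {s t : CurriedTerm L V} :
    R.curry.Step s t ↔ CurriedStep R s t := by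
  constructor
  · intro h
    induction h with
    | root ρ hρ σ =>
      obtain ⟨ρ, hρ, rfl⟩ := hρ
      exact .root ρ hρ σ
    | @arg n f ts i t _ ih =>
      cases f with
      | const f => exact i.elim0
      | ap =>
        have h : ts = ![ts 0, ts 1] := by ext i; fin_cases i <;> rfl
        let g (us : Fin 2 → CurriedTerm L V) : CurriedTerm L V :=
          .func (L := curriedLanguage L) CurriedFunctions.ap us
        change CurriedStep R (g ts) (g (Function.update ts i t))
        fin_cases i
        · have h' : Function.update ts 0 t = ![t, ts 1] := by ext i; fin_cases i <;> rfl
          have := CurriedStep.left (ts 1) ih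
          exact (congrArg₂ (CurriedStep R) (congrArg g h) (congrArg g h')).mpr this
        · have h' : Function.update ts 1 t = ![ts 0, t] := by ext i; fin_cases i <;> rfl
          have := CurriedStep.right (ts 0) ih
          exact (congrArg₂ (CurriedStep R) (congrArg g h) (congrArg g h')).mpr this
  · intro h
    induction h with
    | root ρ hρ σ => exact TRS.Step.root (R := R.curry) ρ.curry ⟨ρ, hρ, rfl⟩ σ
    | @left s s' t _ ih =>
      have := TRS.Step.arg (R := R.curry) (L := curriedLanguage L) CurriedFunctions.ap ![s, t] 0 s' ih
      have h' : Function.update ![s, t] 0 s' = ![s', t] := by ext i; fin_cases i <;> rfl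
      rwa [h'] at this
    | @right s t t' _ ih =>
      have := TRS.Step.arg (R := R.curry) (L := curriedLanguage L) CurriedFunctions.ap ![s, t] 1 t' ih
      have h' : Function.update ![s, t] 1 t' = ![s, t'] := by ext i; fin_cases i <;> rfl
      rwa [h'] at this

variable {R : TRS L V}

theorem curriedStep_apTerm {s t w : CurriedTerm L V} (h : CurriedStep R (apTerm s t) w) :
    (∃ ρ ∈ R, ∃ σ, apTerm s t = fill σ ρ.lhs ∧ w = fill σ ρ.rhs) ∨
      (∃ s', CurriedStep R s s' ∧ w = apTerm s' t) ∨ ∃ t', CurriedStep R t t' ∧ w = apTerm s t' := by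
  generalize e : apTerm s t = x at h
  cases h with
  | root ρ hρ σ => exact .inl ⟨ρ, hρ, σ, rfl, rfl⟩
  | left u h =>
    obtain ⟨rfl, rfl⟩ := apTerm_inj.1 e
    exact .inr (.inl ⟨_, h, rfl⟩)
  | right u h =>
    obtain ⟨rfl, rfl⟩ := apTerm_inj.1 e
    exact .inr (.inr ⟨_, h, rfl⟩)

theorem curriedStep_of_not_isSaturated {a b : CurriedTerm L V} (ha : ¬ IsSaturated a)
    (h : CurriedStep R a b) : ∃ s t, a = apTerm s t ∧
      ((∃ s', CurriedStep R s s' ∧ b = apTerm s' t) ∨ ∃ t', CurriedStep R t t' ∧ b = apTerm s t') := by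
  cases h with
  | root ρ hρ σ => exact absurd (isSaturated_fill_lhs ρ σ) ha
  | left u h => exact ⟨_, _, rfl, .inl ⟨_, h, rfl⟩⟩
  | right u h => exact ⟨_, _, rfl, .inr ⟨_, h, rfl⟩⟩

/-- With at most as many arguments as the arity, every proper prefix of the spine is too short to be
saturated, hence is not a redex. -/
theorem curriedStep_apps {n : ℕ} {f : L.Functions n} {k : ℕ} (hk : k ≤ n)
    {ts : Fin k → CurriedTerm L V} {t : CurriedTerm L V} (h : CurriedStep R (apps f ts) t) :
    (∃ ρ ∈ R, ∃ σ, apps f ts = fill σ ρ.lhs ∧ t = fill σ ρ.rhs) ∨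
      ∃ i t', CurriedStep R (ts i) t' ∧ t = apps f (Function.update ts i t') := by
  induction k generalizing t with
  | zero =>
    generalize e : apps f ts = x at h
    rw [apps_zero] at e
    cases h with
    | root ρ hρ σ => exact .inl ⟨ρ, hρ, σ, rfl, rfl⟩
    | left u h => exact absurd e (constTerm_ne_apTerm _ _ _)
    | right u h => exact absurd e (constTerm_ne_apTerm _ _ _)
  | succ k ih =>
    rw [apps_succ] at h ⊢
    obtain h | ⟨s', hs, rfl⟩ | ⟨t', ht, rfl⟩ := curriedStep_apTerm h
    · exact .inl h
    · obtain ⟨ρ, -, σ, e, -⟩ | ⟨i, t', ht, rfl⟩ := ih (Nat.le_of_succ_le hk) hs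
      · exact absurd (e ▸ isSaturated_fill_lhs ρ σ) (not_isSaturated_apps f _ hk)
      · refine .inr ⟨i.castSucc, t', ht, ?_⟩
        rw [apps_succ]
        congr 1
        · congr 1
          ext j
          simp [Function.update_apply]
        · rw [Function.update_of_ne (Fin.castSucc_lt_last i).ne']
    · refine .inr ⟨Fin.last k, t', ht, ?_⟩
      rw [apps_succ, Function.update_self]
      congr 2
      ext j
      rw [Function.update_of_ne (Fin.castSucc_lt_last j).ne]

/-- Case distinction and induction for rewrite steps along the layers of a curried term. -/
theorem curriedStep_layer_induction {P : CurriedTerm L V → CurriedTerm L V → Prop}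
    (alien : ∀ a b, ¬ IsSaturated a → CurriedStep R a b → P a b)
    (root : ∀ ρ ∈ R, ∀ σ, P (fill σ ρ.lhs) (fill σ ρ.rhs))
    (arg : ∀ {n : ℕ} (f : L.Functions n) (ts : Fin n → CurriedTerm L V) (i : Fin n) (t),
      CurriedStep R (ts i) t → P (ts i) t → P (apps f ts) (apps f (Function.update ts i t)))
    {s t : CurriedTerm L V} (h : CurriedStep R s t) : P s t := by
  induction s using layer_induction generalizing t with
  | alien a ha _ => exact alien a t ha h
  | saturated f ts ih =>
    obtain ⟨ρ, hρ, σ, e, rfl⟩ | ⟨i, t', ht, rfl⟩ := curriedStep_apps le_rfl h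
    · rw [e]; exact root ρ hρ σ
    · exact arg f ts i t' ht (ih i ht)

theorem reduces_apTerm {s s' t t' : CurriedTerm L V} (hs : ReflTransGen (CurriedStep R) s s')
    (ht : ReflTransGen (CurriedStep R) t t') :
    ReflTransGen (CurriedStep R) (apTerm s t) (apTerm s' t') :=
  (hs.lift (fun x => apTerm x t) fun _ _ h => .left t h).trans
    (ht.lift (fun x => apTerm s' x) fun _ _ h => .right s' h)

theorem reduces_apps {n : ℕ} (f : L.Functions n) {k : ℕ} {ts us : Fin k → CurriedTerm L V}
    (h : ∀ i, ReflTransGen (CurriedStep R) (ts i) (us i)) :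
    ReflTransGen (CurriedStep R) (apps f ts) (apps f us) := by
  induction k with
  | zero => rw [Subsingleton.elim ts us]
  | succ k ih => rw [apps_succ, apps_succ]; exact reduces_apTerm (ih fun i => h _) (h _)

theorem reduces_fill {W : Type*} {σ τ : W → CurriedTerm L V} {l : L.Term W}
    (h : ∀ x, OccursIn x l → ReflTransGen (CurriedStep R) (σ x) (τ x)) :
    ReflTransGen (CurriedStep R) (fill σ l) (fill τ l) := by
  induction l with
  | var x => simpa using h x
  | func f ts ih =>
    rw [fill_func, fill_func]
    exact reduces_apps f fun i => ih i fun x hx => h x ((occursIn_func _ _ _).2 ⟨i, hx⟩)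

theorem reduces_fill_of_step (σ : V → CurriedTerm L V) {p q : L.Term V} (h : R.Step p q) :
    ReflTransGen (CurriedStep R) (fill σ p) (fill σ q) := by
  induction h with
  | root ρ hρ τ =>
    rw [fill_subst, fill_subst]
    exact .single (.root ρ hρ _)
  | arg f ts i t _ ih =>
    rw [fill_func, fill_func]
    refine reduces_apps f fun j => ?_
    obtain rfl | hj := eq_or_ne j i
    · simpa using ih
    · rw [Function.update_of_ne hj]

theorem reduces_func_update {n : ℕ} (f : L.Functions n) (ts : Fin n → L.Term V) (i : Fin n)
    {t : L.Term V} (h : ReflTransGen R.Step (ts i) t) :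
    ReflTransGen R.Step (.func f ts) (.func f (Function.update ts i t)) := by
  have := h.lift (p := R.Step) (fun x => .func f (Function.update ts i x)) fun a b hab => by
    have := TRS.Step.arg (R := R) f (Function.update ts i a) i b (by simpa using hab)
    simpa using this
  simpa [Function.onFun] using this

/-! ### Rank -/

/-- The nesting depth of aliens is less than or equal to `n`. -/
def RankLE : ℕ → CurriedTerm L V → Prop
  -- No term has rank 0, so inductions on the rank start vacuously. Aliens that are not applications
  -- impose no condition, and rank 1 means that all aliens are of this kind.
  | 0, _ => False
  | n + 1, t => ∀ a ∈ aliens t, ∀ s u, a = apTerm s u → RankLE n s ∧ RankLE n u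

theorem RankLE.succ {n : ℕ} {t : CurriedTerm L V} (h : RankLE n t) : RankLE (n + 1) t := by
  induction n generalizing t with
  | zero => exact h.elim
  | succ n ih => exact fun a ha s u e => ⟨ih (h a ha s u e).1, ih (h a ha s u e).2⟩

theorem RankLE.mono {n m : ℕ} (hnm : n ≤ m) {t : CurriedTerm L V} (h : RankLE n t) :
    RankLE m t := by
  induction hnm with
  | refl => exact h
  | step _ ih => exact ih.succ

theorem rankLE_of_aliens_subset {n : ℕ} {s t : CurriedTerm L V} (hst : aliens t ⊆ aliens s)
    (h : RankLE n s) : RankLE n t := by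
  cases n with
  | zero => exact h
  | succ n => exact fun a ha => h a (hst ha)

theorem RankLE.of_mem_aliens {n : ℕ} {t a : CurriedTerm L V} (h : RankLE n t)
    (ha : a ∈ aliens t) : RankLE n a := by
  refine rankLE_of_aliens_subset (fun b hb => ?_) h
  rw [mem_aliens_of_not_isSaturated (not_isSaturated_of_mem_aliens ha)] at hb
  rwa [hb]

theorem rankLE_succ_apps_iff {m : ℕ} {n : ℕ} {f : L.Functions n} {ts : Fin n → CurriedTerm L V} :
    RankLE (m + 1) (apps f ts) ↔ ∀ i, RankLE (m + 1) (ts i) := by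
  simp only [RankLE, mem_aliens_apps]
  exact ⟨fun h i a ha => h a ⟨i, ha⟩, fun h a ⟨i, ha⟩ => h i a ha⟩

theorem rankLE_apTerm {n : ℕ} {s t : CurriedTerm L V} (h : ¬ IsSaturated (apTerm s t))
    (hs : RankLE n s) (ht : RankLE n t) : RankLE (n + 1) (apTerm s t) := by
  intro a ha s' t' e
  rw [mem_aliens_of_not_isSaturated h] at ha
  obtain ⟨rfl, rfl⟩ := apTerm_inj.1 (ha.symm.trans e)
  exact ⟨hs, ht⟩

theorem rankLE_of_apTerm {n : ℕ} {s t : CurriedTerm L V} (h : ¬ IsSaturated (apTerm s t))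
    (hr : RankLE (n + 1) (apTerm s t)) : RankLE n s ∧ RankLE n t :=
  hr _ ((mem_aliens_of_not_isSaturated h).2 rfl) s t rfl

theorem RankLE.of_apps {n m : ℕ} {f : L.Functions m} {k : ℕ} (hk : k < m)
    {ts : Fin k → CurriedTerm L V} (h : RankLE n (apps f ts)) (i : Fin k) : RankLE n (ts i) := by
  induction k generalizing n with
  | zero => exact i.elim0
  | succ k ih =>
    cases n with
    | zero => exact h.elim
    | succ n =>
      have hs := not_isSaturated_apps f ts hk
      rw [apps_succ] at h hs
      obtain ⟨h₁, h₂⟩ := rankLE_of_apTerm hs h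
      exact Fin.lastCases h₂.succ (fun i => (ih (Nat.lt_of_succ_lt hk) h₁ i).succ) i

/-- If the application is saturated, then `s` lacks exactly one argument; the arguments along its
spine have rank at most that of `s`, and the last one is `t`. No level is added, in contrast to the
unsaturated case. -/
theorem rankLE_apTerm_of_isSaturated {n : ℕ} {s t : CurriedTerm L V}
    (h : IsSaturated (apTerm s t)) (hs : RankLE n s) (ht : RankLE n t) :
    RankLE n (apTerm s t) := by
  obtain ⟨⟨m, f, ts⟩, e⟩ := h
  cases n with
  | zero => exact hs.elim
  | succ n =>
    rw [e, rankLE_succ_apps_iff]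
    cases m with
    | zero => exact fun i => i.elim0
    | succ m =>
      rw [apps_succ, apTerm_inj] at e
      obtain ⟨rfl, rfl⟩ := e
      exact fun i => Fin.lastCases ht (fun i => hs.of_apps (Nat.lt_succ_self m) i) i

theorem exists_rankLE (t : CurriedTerm L V) : ∃ n, RankLE n t := by
  induction t using layer_induction with
  | alien a ha ih =>
    by_cases h : ∃ s t, a = apTerm s t
    · obtain ⟨s, t, rfl⟩ := h
      obtain ⟨⟨n, hn⟩, ⟨m, hm⟩⟩ := ih s t rfl
      exact ⟨_, rankLE_apTerm ha (hn.mono (le_max_left n m)) (hm.mono (le_max_right n m))⟩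
    · refine ⟨1, fun b hb s t e => absurd ⟨s, t, ?_⟩ h⟩
      rw [mem_aliens_of_not_isSaturated ha] at hb
      exact hb ▸ e
  | saturated f ts ih =>
    choose n hn using ih
    refine ⟨Finset.univ.sup n + 1, rankLE_succ_apps_iff.2 fun i => (hn i).mono ?_⟩
    exact (Finset.le_sup (Finset.mem_univ i)).trans (Nat.le_succ _)

/-- A step inside an alien acts on one of its two immediate subterms, which have smaller rank; the
result is again an alien or merges into a saturated term of even smaller rank. A root step creates
no aliens. -/
theorem RankLE.step {n : ℕ} {s t : CurriedTerm L V} (h : RankLE n s) (hst : CurriedStep R s t) :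
    RankLE n t := by
  induction n generalizing s t with
  | zero => exact h.elim
  | succ n ih =>
    revert h
    refine curriedStep_layer_induction (P := fun s t => RankLE (n + 1) s → RankLE (n + 1) t)
      ?_ ?_ ?_ hst
    · intro a b ha hab h
      obtain ⟨s, t, rfl, ⟨s', hs, rfl⟩ | ⟨t', ht, rfl⟩⟩ := curriedStep_of_not_isSaturated ha hab
      · obtain ⟨h₁, h₂⟩ := rankLE_of_apTerm ha h
        by_cases hb : IsSaturated (apTerm s' t)
        · exact (rankLE_apTerm_of_isSaturated hb (ih h₁ hs) h₂).succ
        · exact rankLE_apTerm hb (ih h₁ hs) h₂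
      · obtain ⟨h₁, h₂⟩ := rankLE_of_apTerm ha h
        by_cases hb : IsSaturated (apTerm s t')
        · exact (rankLE_apTerm_of_isSaturated hb h₁ (ih h₂ ht)).succ
        · exact rankLE_apTerm hb h₁ (ih h₂ ht)
    · exact fun ρ _ σ h => rankLE_of_aliens_subset (aliens_fill_rhs_subset ρ σ) h
    · intro m f ts i t _ iht h
      rw [rankLE_succ_apps_iff] at h ⊢
      intro j
      obtain rfl | hj := eq_or_ne j i
      · simpa using iht (h j)
      · rw [Function.update_of_ne hj]; exact h j

theorem RankLE.reduces {n : ℕ} {s t : CurriedTerm L V} (h : RankLE n s)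
    (hst : ReflTransGen (CurriedStep R) s t) : RankLE n t := by
  induction hst with
  | refl => exact h
  | tail _ h' ih => exact ih.step h'

/-- If an alien reduces to a saturated term, then its rank decreases. -/
theorem RankLE.of_reduces_isSaturated {n : ℕ} {a b : CurriedTerm L V} (h : RankLE (n + 1) a)
    (ha : ¬ IsSaturated a) (hab : ReflTransGen (CurriedStep R) a b) (hb : IsSaturated b) :
    RankLE n b := by
  induction hab using ReflTransGen.head_induction_on with
  | refl => exact absurd hb ha
  | @head a c hac hcb ih =>
    by_cases hc : IsSaturated c
    -- Here `c` is the first saturated term on the way. Its immediate subterms are reducts of those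
    -- of `a`, which have rank at most `n`, and saturation adds no level.
    · refine RankLE.reduces ?_ hcb
      obtain ⟨s, t, rfl, ⟨s', hs, rfl⟩ | ⟨t', ht, rfl⟩⟩ := curriedStep_of_not_isSaturated ha hac
      · exact rankLE_apTerm_of_isSaturated hc ((rankLE_of_apTerm ha h).1.step hs) (rankLE_of_apTerm ha h).2
      · exact rankLE_apTerm_of_isSaturated hc (rankLE_of_apTerm ha h).1 ((rankLE_of_apTerm ha h).2.step ht)
    · exact ih (h.step hac) hc

/-! ### Confluence of terms with preserved aliens -/

/-- No reduct of `a` is saturated. -/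
def Preserved (R : TRS L V) (a : CurriedTerm L V) : Prop :=
  ∀ b, ReflTransGen (CurriedStep R) a b → ¬ IsSaturated b

theorem Preserved.reduct {a b : CurriedTerm L V} (ha : Preserved R a)
    (h : ReflTransGen (CurriedStep R) a b) : Preserved R b :=
  fun _ hc => ha _ (h.trans hc)

/-- The top layer of `t`, with its aliens abstracted to variables by means of `c`. -/
noncomputable def abstractAliens (c : CurriedTerm L V → V) (t : CurriedTerm L V) : L.Term V :=
  (top t).subst fun a => .var (c a)

theorem abstractAliens_apps (c : CurriedTerm L V → V) {n : ℕ} (f : L.Functions n)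
    (ts : Fin n → CurriedTerm L V) :
    abstractAliens c (apps f ts) = .func f fun i => abstractAliens c (ts i) := by
  simp [abstractAliens, top_apps, Term.subst]

theorem abstractAliens_of_not_isSaturated (c : CurriedTerm L V → V) {t : CurriedTerm L V}
    (h : ¬ IsSaturated t) : abstractAliens c t = .var (c t) := by
  simp [abstractAliens, top_of_not_isSaturated h, Term.subst]

theorem fill_abstractAliens (c : CurriedTerm L V → V) (σ : V → CurriedTerm L V)
    (t : CurriedTerm L V) : fill σ (abstractAliens c t) = fill (fun a => σ (c a)) (top t) := by
  simp [abstractAliens, fill_subst]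

theorem abstractAliens_fill (c : CurriedTerm L V → V) (σ : V → CurriedTerm L V) (l : L.Term V) :
    abstractAliens c (fill σ l) = l.subst fun x => abstractAliens c (σ x) := by
  induction l with
  | var x => simp [Term.subst]
  | func f ts ih => simp [Term.subst, abstractAliens_apps, ih]

/-- All aliens of `t` are preserved, and rewriting is confluent at them. -/
def StableAliens (R : TRS L V) (t : CurriedTerm L V) : Prop :=
  ∀ a ∈ aliens t, ConfluentAt (CurriedStep R) a ∧ Preserved R a

/-- A step in an alien yields an alien again, by preservation, and in the same joinability class, by
confluence, so the abstraction does not change. Other steps become steps of `R`. Equal aliens get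
equal variables, so rules that are not left-linear cause no problem. -/
theorem StableAliens.step {s t : CurriedTerm L V} (hs : StableAliens R s) (h : CurriedStep R s t)
    (ι : Set (CurriedTerm L V) → V) :
    StableAliens R t ∧ ReflTransGen R.Step
      (abstractAliens (fun a => ι (joinClass (CurriedStep R) a)) s)
      (abstractAliens (fun a => ι (joinClass (CurriedStep R) a)) t) := by
  revert hs
  set c : CurriedTerm L V → V := fun a => ι (joinClass (CurriedStep R) a) with hc
  refine curriedStep_layer_induction (P := fun s t => StableAliens R s → StableAliens R t ∧
    ReflTransGen R.Step (abstractAliens c s) (abstractAliens c t)) ?_ ?_ ?_ h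
  · intro a b ha hab hs
    obtain ⟨hca, hpa⟩ := hs a ((mem_aliens_of_not_isSaturated ha).2 rfl)
    have hab := ReflTransGen.single hab
    have hb := hpa b hab
    refine ⟨fun x hx => ?_, ?_⟩
    · obtain rfl := (mem_aliens_of_not_isSaturated hb).1 hx
      exact ⟨hca.reduct hab, hpa.reduct hab⟩
    · rw [abstractAliens_of_not_isSaturated c ha, abstractAliens_of_not_isSaturated c hb, hc]
      simp only [joinClass_eq_of_reduces hca hab]
      exact .refl
  · intro ρ hρ σ hs
    refine ⟨fun a ha => hs a (aliens_fill_rhs_subset ρ σ ha), ?_⟩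
    rw [abstractAliens_fill, abstractAliens_fill]
    exact .single (.root ρ hρ _)
  · intro n f ts i t _ ih hs
    have ih := ih fun a ha => hs a (mem_aliens_apps.2 ⟨i, ha⟩)
    refine ⟨fun a ha => ?_, ?_⟩
    · obtain ⟨j, hj⟩ := mem_aliens_apps.1 ha
      obtain rfl | hji := eq_or_ne j i
      · exact ih.1 a (by simpa using hj)
      · rw [Function.update_of_ne hji] at hj
        exact hs a (mem_aliens_apps.2 ⟨j, hj⟩)
    · rw [abstractAliens_apps, abstractAliens_apps]
      convert reduces_func_update f (fun j => abstractAliens c (ts j)) i ih.2 using 2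
      ext j
      obtain rfl | hji := eq_or_ne j i
      · simp
      · simp [Function.update_of_ne hji]

theorem StableAliens.reduces {s t : CurriedTerm L V} (hs : StableAliens R s)
    (h : ReflTransGen (CurriedStep R) s t) (ι : Set (CurriedTerm L V) → V) :
    StableAliens R t ∧ ReflTransGen R.Step
      (abstractAliens (fun a => ι (joinClass (CurriedStep R) a)) s)
      (abstractAliens (fun a => ι (joinClass (CurriedStep R) a)) t) := by
  induction h with
  | refl => exact ⟨hs, .refl⟩
  | tail _ h ih =>
    have := ih.1.step h ι
    exact ⟨this.1, ih.2.trans this.2⟩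

theorem finite_aliens (t : CurriedTerm L V) : (aliens t).Finite :=
  finite_occursIn (top t)

theorem StableAliens.confluentAt [Infinite V] (hR : R.IsConfluent) {t : CurriedTerm L V}
    (ht : StableAliens R t) : ConfluentAt (CurriedStep R) t := by
  classical
  intro b c hb hc
  -- Only the aliens of the two ends of the peak must be told apart. They form finitely many
  -- classes, which the infinite set `V` can name injectively.
  have hfin := (finite_aliens b).union (finite_aliens c)
  obtain ⟨e, he⟩ :=
    Set.countable_iff_exists_injOn.1 (hfin.image (joinClass (CurriedStep R))).countable
  let ι : Set (CurriedTerm L V) → V := fun A => Infinite.natEmbedding V (e A)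
  obtain ⟨hsb, htb⟩ := ht.reduces hb ι
  obtain ⟨hsc, htc⟩ := ht.reduces hc ι
  obtain ⟨d, hbd, hcd⟩ := hR _ _ _ htb htc
  have hconf : ∀ a ∈ aliens b ∪ aliens c, ConfluentAt (CurriedStep R) a := by
    rintro a (ha | ha)
    exacts [(hsb a ha).1, (hsc a ha).1]
  have hz : ∀ x : V, ∃ z, ∀ a ∈ aliens b ∪ aliens c, ι (joinClass (CurriedStep R) a) = x →
      ReflTransGen (CurriedStep R) a z := by
    intro x
    -- A variable that names none of these classes gets an arbitrary value.
    have : Nonempty (CurriedTerm L V) := ⟨t⟩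
    obtain ⟨z, hz⟩ := exists_common_reduct (r := CurriedStep R)
      (hfin.toFinset.filter fun a => ι (joinClass (CurriedStep R) a) = x)
      (fun a ha => hconf a (by simpa using (Finset.mem_filter.1 ha).1)) fun a ha a' ha' => by
        rw [Finset.mem_filter, Set.Finite.mem_toFinset] at ha ha'
        refine join_of_joinClass_eq (hconf a' ha'.1) (he ⟨a, ha.1, rfl⟩ ⟨a', ha'.1, rfl⟩ ?_)
        exact (Infinite.natEmbedding V).injective (ha.2.trans ha'.2.symm)
    exact ⟨z, fun a ha hx => hz a (by
      rw [Finset.mem_filter, Set.Finite.mem_toFinset]; exact ⟨ha, hx⟩)⟩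
  choose z hz using hz
  -- Reducing each alien to the representative of its class turns `s` into an instance of its
  -- abstraction, on which the `R`-reduction to `d` can be replayed.
  have key : ∀ s : CurriedTerm L V, aliens s ⊆ aliens b ∪ aliens c →
      ReflTransGen R.Step (abstractAliens (fun a => ι (joinClass (CurriedStep R) a)) s) d →
      ReflTransGen (CurriedStep R) s (fill z d) := by
    intro s hs hsd
    have h₁ : ReflTransGen (CurriedStep R) (fill id (top s))
        (fill (fun a => z (ι (joinClass (CurriedStep R) a))) (top s)) :=
      reduces_fill fun a ha => hz _ a (hs ha) rfl
    rw [fill_top, ← fill_abstractAliens] at h₁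
    refine h₁.trans ?_
    clear hbd hcd
    induction hsd with
    | refl => exact .refl
    | tail _ h ih => exact ih.trans (reduces_fill_of_step z h)
  exact ⟨fill z d, key b Set.subset_union_left hbd, key c Set.subset_union_right hcd⟩

/-! ### Reduction to terms with preserved aliens -/

theorem exists_reduct_preserved_aliens {n : ℕ} {t : CurriedTerm L V} (h : RankLE n t) :
    ∃ t', ReflTransGen (CurriedStep R) t t' ∧ ∀ a ∈ aliens t', Preserved R a := by
  induction n generalizing t with
  | zero => exact h.elim
  | succ n ih =>
    have hw : ∀ a, ∃ a', a ∈ aliens t →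
        ReflTransGen (CurriedStep R) a a' ∧ ∀ b ∈ aliens a', Preserved R b := by
      intro a
      by_cases ha : a ∈ aliens t
      · have hsat := not_isSaturated_of_mem_aliens ha
        by_cases hp : Preserved R a
        · refine ⟨a, fun _ => ⟨.refl, fun b hb => ?_⟩⟩
          rwa [(mem_aliens_of_not_isSaturated hsat).1 hb]
        · simp only [Preserved, not_forall, not_not] at hp
          obtain ⟨b, hab, hb⟩ := hp
          -- An alien that is not preserved is first reduced to a saturated term, whose smaller rank
          -- admits the induction hypothesis.
          obtain ⟨t', hbt, ht'⟩ := ih ((h.of_mem_aliens ha).of_reduces_isSaturated hsat hab hb)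
          exact ⟨t', fun _ => ⟨hab.trans hbt, ht'⟩⟩
      · exact ⟨a, fun h => absurd h ha⟩
    choose w hw using hw
    refine ⟨fill w (top t), ?_, fun a ha => ?_⟩
    · have := reduces_fill (R := R) (σ := id) (τ := w) (l := top t) fun a ha => (hw a ha).1
      rwa [fill_top] at this
    · obtain ⟨x, hx, hax⟩ := mem_aliens_fill.1 ha
      exact (hw x hx).2 a hax

/-! ### Confluence by induction on the rank -/

theorem confluentAt_apTerm {n : ℕ} {s t : CurriedTerm L V} (hs : RankLE n s) (ht : RankLE n t)
    (ih : ∀ t : CurriedTerm L V, RankLE n t → ConfluentAt (CurriedStep R) t) :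
    ConfluentAt (CurriedStep R) (apTerm s t) := by
  -- A reduction works on the two components separately until the application is saturated and hence
  -- of rank at most `n`. From there on the pair is frozen and the rest of the reduction is left to
  -- the induction hypothesis.
  have key : ∀ b, ReflTransGen (CurriedStep R) (apTerm s t) b → ∃ s' t',
      ReflTransGen (CurriedStep R) s s' ∧ ReflTransGen (CurriedStep R) t t' ∧
        ReflTransGen (CurriedStep R) (apTerm s' t') b ∧
        (b = apTerm s' t' ∨ RankLE n (apTerm s' t')) := by
    intro b hb
    induction hb with
    | refl => exact ⟨s, t, .refl, .refl, .refl, .inl rfl⟩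
    | tail _ hbc ih =>
      obtain ⟨s', t', hs', ht', hb, rfl | hr⟩ := ih
      · by_cases hsat : IsSaturated (apTerm s' t')
        · exact ⟨s', t', hs', ht', .single hbc, .inr
            (rankLE_apTerm_of_isSaturated hsat (hs.reduces hs') (ht.reduces ht'))⟩
        · obtain ⟨s₁, t₁, e, h⟩ := curriedStep_of_not_isSaturated hsat hbc
          obtain ⟨rfl, rfl⟩ := apTerm_inj.1 e
          obtain ⟨s₂, h, rfl⟩ | ⟨t₂, h, rfl⟩ := h
          · exact ⟨s₂, _, hs'.tail h, ht', .refl, .inl rfl⟩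
          · exact ⟨_, t₂, hs', ht'.tail h, .refl, .inl rfl⟩
      · exact ⟨s', t', hs', ht', hb.tail hbc, .inr hr⟩
  intro b c hb hc
  obtain ⟨s₁, t₁, hs₁, ht₁, hb', hb⟩ := key b hb
  obtain ⟨s₂, t₂, hs₂, ht₂, hc', hc⟩ := key c hc
  obtain ⟨s₃, h₁, h₂⟩ := ih s hs _ _ hs₁ hs₂
  obtain ⟨t₃, h₁', h₂'⟩ := ih t ht _ _ ht₁ ht₂
  have hx₁ := reduces_apTerm h₁ h₁'
  have hx₂ := reduces_apTerm h₂ h₂'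
  obtain rfl | hb := hb
  · obtain rfl | hc := hc
    · exact ⟨_, hx₁, hx₂⟩
    · obtain ⟨z, hz, hz'⟩ := ih _ hc _ _ hx₂ hc'
      exact ⟨z, hx₁.trans hz, hz'⟩
  · obtain ⟨z, hbz, hz⟩ := ih _ hb _ _ hb' hx₁
    obtain rfl | hc := hc
    · exact ⟨z, hbz, hx₂.trans hz⟩
    · obtain ⟨y, hzy, hcy⟩ := ih _ hc _ _ (hx₂.trans hz) hc'
      exact ⟨y, hbz.trans hzy, hcy⟩

theorem confluentAt_of_rankLE [Infinite V] (hR : R.IsConfluent) {n : ℕ} {t : CurriedTerm L V}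
    (ht : RankLE n t) : ConfluentAt (CurriedStep R) t := by
  induction n generalizing t with
  | zero => exact ht.elim
  | succ n ih =>
    have halien : ∀ a : CurriedTerm L V, RankLE (n + 1) a → ¬ IsSaturated a →
        ConfluentAt (CurriedStep R) a := by
      intro a hr ha b c hb hc
      by_cases h : ∃ s t, a = apTerm s t
      · obtain ⟨s, t, rfl⟩ := h
        obtain ⟨hs, ht⟩ := rankLE_of_apTerm ha hr
        exact confluentAt_apTerm hs ht (fun _ => ih) b c hb hc
      · have hnf : ∀ b, ¬ CurriedStep R a b := fun b hb => by
          obtain ⟨s, t, e, -⟩ := curriedStep_of_not_isSaturated ha hb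
          exact h ⟨s, t, e⟩
        obtain rfl | ⟨x, hx, -⟩ := hb.cases_head
        · exact ⟨c, hc, .refl⟩
        · exact absurd hx (hnf x)
    -- One choice of reducts, made for all terms of any rank, serves the whole peak: equal aliens
    -- have equal replacements, so `W` commutes with instances.
    choose w hw hwp using fun a : CurriedTerm L V =>
      exists_reduct_preserved_aliens (R := R) (exists_rankLE a).choose_spec
    let W : CurriedTerm L V → CurriedTerm L V := fun t => fill w (top t)
    have hW : ∀ t, ReflTransGen (CurriedStep R) t (W t) := fun t => by
      have := reduces_fill (R := R) (σ := id) (τ := w) (l := top t) fun a _ => hw a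
      rwa [fill_top] at this
    -- The aliens of `W t` are preserved by the choice of `w`, and `halien` gives confluence at
    -- them, since reduction has not increased the rank.
    have hWc : ∀ t, RankLE (n + 1) t → ConfluentAt (CurriedStep R) (W t) := by
      refine fun t ht => StableAliens.confluentAt hR fun a ha => ?_
      refine ⟨halien a ((ht.reduces (hW t)).of_mem_aliens ha) (not_isSaturated_of_mem_aliens ha), ?_⟩
      obtain ⟨x, -, hax⟩ := mem_aliens_fill.1 ha
      exact hwp x a hax
    have hWfill : ∀ (σ : V → CurriedTerm L V) (l : L.Term V),
        W (fill σ l) = fill (fun x => W (σ x)) l := fun σ l => by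
      simp only [W, top_fill, fill_subst]
    have hWapps : ∀ {m : ℕ} (f : L.Functions m) (ts : Fin m → CurriedTerm L V),
        W (apps f ts) = apps f fun i => W (ts i) := fun f ts => by
      simp only [W, top_apps, fill_func]
    have hstep : ∀ s t, CurriedStep R s t → RankLE (n + 1) s →
        Join (ReflTransGen (CurriedStep R)) (W s) (W t) := by
      intro s t hst
      refine curriedStep_layer_induction (P := fun s t => RankLE (n + 1) s →
        Join (ReflTransGen (CurriedStep R)) (W s) (W t)) ?_ ?_ ?_ hst
      -- Both `W a` and `W b` are reducts of the alien `a`, at which rewriting is confluent.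
      · exact fun a b ha hab hr => halien a hr ha _ _ (hW a) ((hW b).head hab)
      · intro ρ hρ σ _
        rw [hWfill, hWfill]
        exact ⟨_, .single (.root ρ hρ _), .refl⟩
      · intro m f ts i t _ iht hr
        obtain ⟨z, h₁, h₂⟩ := iht (rankLE_succ_apps_iff.1 hr i)
        rw [hWapps, hWapps]
        refine ⟨apps f (Function.update (fun j => W (ts j)) i z), reduces_apps f fun j => ?_,
          reduces_apps f fun j => ?_⟩ <;> obtain rfl | hj := eq_or_ne j i
        · simpa using h₁
        · simp only [Function.update_of_ne hj]; exact .refl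
        · simpa using h₂
        · simp only [Function.update_of_ne hj]; exact .refl
    have hsteps : ∀ b, ReflTransGen (CurriedStep R) t b →
        Join (ReflTransGen (CurriedStep R)) (W t) (W b) := by
      intro b hb
      induction hb with
      | refl => exact ⟨_, .refl, .refl⟩
      | @tail b c hb hbc ih =>
        have hr := ht.reduces hb
        exact (hWc b hr).join_trans ih (hstep b c hbc hr)
    -- The terms `W b`, `W t` and `W c` are joinable in turn, and confluence at `W t` closes the
    -- gap.
    intro b c hb hc
    obtain ⟨z, hbz, hcz⟩ :=
      (hWc t ht).join_trans (join_symm (hsteps b hb)) (hsteps c hc)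
    exact ⟨z, (hW b).trans hbz, (hW c).trans hcz⟩

end Curried

end Rewriting

theorem mainTheorem9 {L : FirstOrder.Language.{u, v}} {V : Type w}
    [Countable V] [Infinite V] (R : Rewriting.TRS L V) (hR : R.IsConfluent) :
    R.curry.IsConfluent := by
  have h : R.curry.Step = Rewriting.CurriedStep R := by
    ext s t
    exact Rewriting.step_curry_iff
  rw [Rewriting.TRS.IsConfluent, h]
  intro t
  obtain ⟨n, hn⟩ := Rewriting.exists_rankLE t
  exact Rewriting.confluentAt_of_rankLE hR hn
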